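/- All Banach spaces are real. A subset $A$ of a Banach space $X$ is \emph{finitely represented} in a subset $B$ of a Banach space $Y$ if for every $\varepsilon>0$ and every finite linearly independent set $A_0\subset A$ there are $B_0\subset B$ and a linear isomorphism $T:\operatorname{span}(A_0)\to\operatorname{span}(B_0)$ with $T(A_0)\subset B$ and $(1-\varepsilon)\|x\|\le\|Tx\|\le(1+\varepsilon)\|x\|$ for all $x\in\operatorname{span}(A_0)$. A subset $A$ of a Banach space is \emph{super weakly compact} if it is bounded and weakly closed and every subset of a Banach space that is finitely represented in $A$ is relatively weakly compact. Let $D$ be a convex subset of a Banach space $Y$, let $T:D\to D$ be affine, and put $S_nx=\frac1n\sum_{k=0}^{n-1}T^kx$ for $n\ge1$ and $x\in D$. The map $T$ is \emph{ergodic} if $(S_nx)_n$ converges in the norm of $Y$ for every $x\in D$. It is \emph{Cesàro equicontinuous} if the family $(S_n)_{n\ge1}$ is equicontinuous at every point of $D$. The set $D$ is \emph{ergodic} if every Cesàro equicontinuous affine map $T:D\to D$ is ergodic. **Theorem.** Let $C$ be a closed convex subset of a Banach space $X$. The following are equivalent: (i) $C$ is super weakly compact; (ii) $C$ is super-ergodic,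 that is, every closed convex subset of a Banach space that is finitely represented in $C$ is ergodic; (iii) for every convex subset $D$ of a Banach space that is finitely represented in $C$, every affine isometry (not necessarily onto) of $D$ into itself is ergodic. -/

import Mathlib

open Filter Topology

universe u v

/-- `A` is finitely represented in `B`: every finite linearly independent subset of `A` is carried
into `B` by a `(1 ± ε)`-isomorphism between the span of that subset and the span of a subset
of `B`. -/
def FinitelyRepresented {X : Type u} [NormedAddCommGroup X] [NormedSpace ℝ X]
    {Y : Type v} [NormedAddCommGroup Y] [NormedSpace ℝ Y] (A : Set X) (B : Set Y) : Prop :=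
  ∀ ε : ℝ, 0 < ε → ∀ A₀ : Set X, A₀ ⊆ A → A₀.Finite → LinearIndepOn ℝ id A₀ →
    ∃ B₀ : Set Y, B₀ ⊆ B ∧
      ∃ T : Submodule.span ℝ A₀ ≃ₗ[ℝ] Submodule.span ℝ B₀,
        (∀ x : Submodule.span ℝ A₀, (x : X) ∈ A₀ → (T x : Y) ∈ B) ∧
        ∀ x : Submodule.span ℝ A₀, (1 - ε) * ‖x‖ ≤ ‖T x‖ ∧ ‖T x‖ ≤ (1 + ε) * ‖x‖

/-- The closure of `A` in the weak topology is weakly compact. -/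
def IsRelativelyWeaklyCompact {X : Type u} [NormedAddCommGroup X] [NormedSpace ℝ X]
    (A : Set X) : Prop :=
  IsCompact (closure (toWeakSpace ℝ X '' A))

/-- `A` is bounded, weakly closed, and every subset of a Banach space that is finitely represented
in `A` is relatively weakly compact. The test spaces range over an arbitrary universe `v`. -/
def IsSuperWeaklyCompact {X : Type u} [NormedAddCommGroup X] [NormedSpace ℝ X]
    (A : Set X) : Prop :=
  Bornology.IsBounded A ∧ IsClosed (toWeakSpace ℝ X '' A) ∧
    ∀ (Y : Type v) [NormedAddCommGroup Y] [NormedSpace ℝ Y] [CompleteSpace Y] (D : Set Y),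
      FinitelyRepresented D A → IsRelativelyWeaklyCompact D

/-- `T` is a self-map of the convex set `D` that is affine there. Self-maps of `D` are represented
by functions on the whole space; the values outside `D` play no role. -/
def IsAffineSelfMap {Y : Type v} [NormedAddCommGroup Y] [NormedSpace ℝ Y]
    (D : Set Y) (T : Y → Y) : Prop :=
  Set.MapsTo T D D ∧
    ∀ x ∈ D, ∀ y ∈ D, ∀ a b : ℝ, 0 ≤ a → 0 ≤ b → a + b = 1 →
      T (a • x + b • y) = a • T x + b • T y

/-- The Cesàro mean `(1 / n) ∑_{k < n} T^k x` (used for `n ≥ 1`). -/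
noncomputable def cesaroMean {Y : Type v} [NormedAddCommGroup Y] [NormedSpace ℝ Y]
    (T : Y → Y) (n : ℕ) (x : Y) : Y :=
  (n : ℝ)⁻¹ • ∑ k ∈ Finset.range n, T^[k] x

/-- The Cesàro means of `T` converge in norm at every point of `D`. -/
def IsErgodicMapOn {Y : Type v} [NormedAddCommGroup Y] [NormedSpace ℝ Y]
    (D : Set Y) (T : Y → Y) : Prop :=
  ∀ x ∈ D, ∃ y : Y, Tendsto (fun n : ℕ => cesaroMean T n x) atTop (𝓝 y)

/-- The Cesàro means of `T`, of all orders `n ≥ 1`, are equicontinuous on `D`. -/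
def IsCesaroEquicontinuousOn {Y : Type v} [NormedAddCommGroup Y] [NormedSpace ℝ Y]
    (D : Set Y) (T : Y → Y) : Prop :=
  EquicontinuousOn (fun (n : ℕ) (x : Y) => cesaroMean T (n + 1) x) D

/-- Ergodicity of a convex set `D`. -/
def IsErgodicSet {Y : Type v} [NormedAddCommGroup Y] [NormedSpace ℝ Y] (D : Set Y) : Prop :=
  ∀ T : Y → Y, IsAffineSelfMap D T → IsCesaroEquicontinuousOn D T → IsErgodicMapOn D T

/-- Every closed convex subset of a Banach space that is finitely represented in `C` is ergodic. -/
def IsSuperErgodic {X : Type u} [NormedAddCommGroup X] [NormedSpace ℝ X] (C : Set X) : Prop :=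
  ∀ (Y : Type v) [NormedAddCommGroup Y] [NormedSpace ℝ Y] [CompleteSpace Y] (D : Set Y),
    IsClosed D → Convex ℝ D → FinitelyRepresented D C → IsErgodicSet D

/-- Every affine isometry (not necessarily onto) of a convex subset `D` of a Banach space into
itself is ergodic, as soon as `D` is finitely represented in `C`. -/
def AffineIsometriesSuperErgodic {X : Type u} [NormedAddCommGroup X] [NormedSpace ℝ X]
    (C : Set X) : Prop :=
  ∀ (Y : Type v) [NormedAddCommGroup Y] [NormedSpace ℝ Y] [CompleteSpace Y] (D : Set Y),
    Convex ℝ D → FinitelyRepresented D C →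
      ∀ T : Y → Y, IsAffineSelfMap D T → (∀ x ∈ D, ∀ y ∈ D, ‖T x - T y‖ = ‖x - y‖) →
        IsErgodicMapOn D T

/-! ### Stability properties of finite representability -/

section FiniteRepresentability

/-! From (i) to (ii) this is the mean ergodic theorem. A weak cluster point of the Cesàro means is
fixed by `T`, because the graph of `T` is convex and so has a weakly closed norm closure. It is a
norm limit of convex combinations of the orbit, and equicontinuity at this point upgrades this to
norm convergence of the means. For (iii), an isometry extends to the closure, and its means are
1-Lipschitz.

From (iii) to (i) a failure of (i) yields a non-ergodic isometry. Given a filter on sequences `s`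
along which all norms `‖∑ aᵢ sᵢ‖` converge, the limits form a seminorm on finitely supported `a`. In
its completion the simplex of unit vectors is finitely represented in `C`. If the seminorm is shift
invariant on vectors of coordinate sum zero, the shift is an affine isometry of that simplex. It is
not ergodic once its means of orders `n` and `2n` stay apart
(`not_affineIsometriesSuperErgodic_of_model`).

If `C` is unbounded, `s` consists of equally spaced points on ever longer segments. If some `D`
finitely represented in `C` is not relatively weakly compact, an ultrafilter on `D` converges weak*
to a bidual point `φ` outside the space. Its iterated products give the shift invariance, and the
positive distance from `φ` to the space gives the separation. -/

/-- Values prescribed on a linearly independent set extend linearly to its span. -/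
theorem LinearIndepOn.exists_linearMap_span {Z E : Type*} [AddCommGroup Z] [Module ℝ Z]
    [AddCommGroup E] [Module ℝ E] {A : Set Z} (hA : LinearIndepOn ℝ id A) (g : Z → E) :
    ∃ R : Submodule.span ℝ A →ₗ[ℝ] E, ∀ x : Submodule.span ℝ A, (x : Z) ∈ A → R x = g x := by
  have hli : LinearIndependent ℝ (fun a : A => (a : Z)) := hA
  let b := Module.Basis.span hli
  have hr : Set.range (fun a : A => (a : Z)) = A := Subtype.range_coe
  let e : Submodule.span ℝ A ≃ₗ[ℝ] Submodule.span ℝ (Set.range (fun a : A => (a : Z))) :=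
    LinearEquiv.ofEq _ _ (by rw [hr])
  refine ⟨(b.constr ℝ fun a : A => g a) ∘ₗ e.toLinearMap, fun x hx => ?_⟩
  have h1 : e x = b ⟨x, hx⟩ := by
    apply Subtype.ext
    rw [Module.Basis.span_apply]
    rfl
  simp [h1, Module.Basis.constr_basis]

variable {X : Type*} [NormedAddCommGroup X] [NormedSpace ℝ X]
  {Y : Type*} [NormedAddCommGroup Y] [NormedSpace ℝ Y]
  {Z : Type*} [NormedAddCommGroup Z] [NormedSpace ℝ Z]

theorem FinitelyRepresented.exists_linearMap {A : Set X} {B : Set Y}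
    (h : FinitelyRepresented A B) {ε : ℝ} (hε : 0 < ε) {A₀ : Set X} (hA₀ : A₀ ⊆ A)
    (hfin : A₀.Finite) (hli : LinearIndepOn ℝ id A₀) :
    ∃ S : Submodule.span ℝ A₀ →ₗ[ℝ] Y,
      (∀ x : Submodule.span ℝ A₀, (x : X) ∈ A₀ → S x ∈ B) ∧
      ∀ x : Submodule.span ℝ A₀, (1 - ε) * ‖x‖ ≤ ‖S x‖ ∧ ‖S x‖ ≤ (1 + ε) * ‖x‖ := by
  obtain ⟨B₀, -, T, hT, hn⟩ := h ε hε A₀ hA₀ hfin hli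
  exact ⟨(Submodule.subtype _) ∘ₗ T.toLinearMap, hT, hn⟩

/-- For `ε < 1` the lower estimate forces injectivity, so the image of `A₀` serves as `B₀`, and its
span is the range. -/
theorem finitelyRepresented_of_exists_linearMap {A : Set X} {B : Set Y}
    (h : ∀ ε : ℝ, 0 < ε → ε < 1 → ∀ A₀ : Set X, A₀ ⊆ A → A₀.Finite → LinearIndepOn ℝ id A₀ →
      ∃ S : Submodule.span ℝ A₀ →ₗ[ℝ] Y,
        (∀ x : Submodule.span ℝ A₀, (x : X) ∈ A₀ → S x ∈ B) ∧
        ∀ x : Submodule.span ℝ A₀, (1 - ε) * ‖x‖ ≤ ‖S x‖ ∧ ‖S x‖ ≤ (1 + ε) * ‖x‖) :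
    FinitelyRepresented A B := by
  intro ε hε A₀ hA₀ hfin hli
  obtain ⟨S, hS, hn⟩ := h (min ε (1 / 2)) (by positivity)
    ((min_le_right _ _).trans_lt (by norm_num)) A₀ hA₀ hfin hli
  have hinj : Function.Injective S := by
    rw [injective_iff_map_eq_zero]
    intro x hx
    have h1 := (hn x).1
    rw [hx, norm_zero] at h1
    have h2 : min ε (1 / 2) ≤ 1 / 2 := min_le_right _ _
    have h3 : ‖x‖ ≤ 0 := by nlinarith [norm_nonneg x]
    exact norm_le_zero_iff.1 h3
  let B₀ : Set Y := S '' ((↑) ⁻¹' A₀)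
  have hrange : LinearMap.range S = Submodule.span ℝ B₀ := by
    rw [LinearMap.range_eq_map, Submodule.span_image, Submodule.span_span_coe_preimage]
  refine ⟨B₀, ?_, (LinearEquiv.ofInjective S hinj).trans (LinearEquiv.ofEq _ _ hrange), ?_, ?_⟩
  · rintro _ ⟨x, hx, rfl⟩
    exact hS x hx
  · intro x hx
    exact hS x hx
  · intro x
    have h1 := hn x
    have h2 : ‖((LinearEquiv.ofInjective S hinj).trans (LinearEquiv.ofEq _ _ hrange)) x‖ = ‖S x‖ :=
      rfl
    rw [h2]
    have h3 : min ε (1 / 2) ≤ ε := min_le_left _ _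
    constructor <;> nlinarith [norm_nonneg x]

/-- It suffices to represent finite pieces in sets that are themselves finitely represented. -/
theorem finitelyRepresented_of_exists_intermediate {A : Set X} {B : Set Z}
    (h : ∀ ε : ℝ, 0 < ε → ∀ A₀ : Set X, A₀ ⊆ A → A₀.Finite → LinearIndepOn ℝ id A₀ →
      ∃ D : Set Y, FinitelyRepresented D B ∧ ∃ S : Submodule.span ℝ A₀ →ₗ[ℝ] Y,
        (∀ x : Submodule.span ℝ A₀, (x : X) ∈ A₀ → S x ∈ D) ∧
        ∀ x : Submodule.span ℝ A₀, (1 - ε) * ‖x‖ ≤ ‖S x‖ ∧ ‖S x‖ ≤ (1 + ε) * ‖x‖) :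
    FinitelyRepresented A B := by
  refine finitelyRepresented_of_exists_linearMap fun ε hε hε1 A₀ hA₀ hfin hli => ?_
  -- Two distortions are composed; `(1 ± ε/3)²` stays within `1 ± ε` for `ε < 1`.
  obtain ⟨D, hD, S, hS, hn⟩ := h (ε / 3) (by positivity) A₀ hA₀ hfin hli
  have hinj : Function.Injective S := by
    rw [injective_iff_map_eq_zero]
    intro x hx
    have h1 := (hn x).1
    rw [hx, norm_zero] at h1
    exact norm_le_zero_iff.1 (by nlinarith [norm_nonneg x])
  let B₀ : Set Y := S '' ((↑) ⁻¹' A₀)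
  have hpre : LinearIndepOn ℝ id ((↑) ⁻¹' A₀ : Set (Submodule.span ℝ A₀)) := by
    have : LinearIndepOn ℝ (Submodule.subtype (Submodule.span ℝ A₀))
        ((↑) ⁻¹' A₀ : Set (Submodule.span ℝ A₀)) := by
      rw [linearIndepOn_iff_image (Submodule.subtype_injective _).injOn]
      exact hli.mono (Set.image_preimage_subset _ _)
    exact LinearIndepOn.of_comp (Submodule.subtype (Submodule.span ℝ A₀)) this
  have hB₀li : LinearIndepOn ℝ id B₀ := by
    rw [← linearIndepOn_iff_image hinj.injOn]
    exact hpre.map_injOn S hinj.injOn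
  obtain ⟨S', hS', hn'⟩ := hD.exists_linearMap (ε := ε / 3) (by positivity) (A₀ := B₀)
    (by rintro _ ⟨x, hx, rfl⟩; exact hS x hx)
    ((hfin.preimage Subtype.val_injective.injOn).image _) hB₀li
  have hmem : ∀ x, S x ∈ Submodule.span ℝ B₀ := by
    intro x
    have : LinearMap.range S = Submodule.span ℝ B₀ := by
      rw [LinearMap.range_eq_map, Submodule.span_image, Submodule.span_span_coe_preimage]
    rw [← this]
    exact ⟨x, rfl⟩
  refine ⟨S' ∘ₗ S.codRestrict _ hmem, fun x hx => hS' _ ⟨x, hx, rfl⟩, fun x => ?_⟩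
  have h1 := hn x
  have h2 := hn' (S.codRestrict _ hmem x)
  have h3 : ‖S.codRestrict _ hmem x‖ = ‖S x‖ := rfl
  rw [h3] at h2
  rw [LinearMap.comp_apply]
  have h4 := norm_nonneg x
  constructor
  · calc (1 - ε) * ‖x‖ ≤ (1 - ε / 3) * ((1 - ε / 3) * ‖x‖) := by nlinarith [mul_nonneg hε.le h4]
      _ ≤ (1 - ε / 3) * ‖S x‖ := mul_le_mul_of_nonneg_left h1.1 (by linarith)
      _ ≤ _ := h2.1
  · calc _ ≤ (1 + ε / 3) * ‖S x‖ := h2.2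
      _ ≤ (1 + ε / 3) * ((1 + ε / 3) * ‖x‖) := mul_le_mul_of_nonneg_left h1.2 (by linarith)
      _ ≤ _ := by nlinarith [mul_nonneg hε.le h4, mul_nonneg (mul_nonneg hε.le hε.le) h4]

theorem FinitelyRepresented.mono_left {A A' : Set X} {B : Set Y} (h : FinitelyRepresented A B)
    (hA : A' ⊆ A) : FinitelyRepresented A' B :=
  fun ε hε A₀ hA₀ hfin hli => h ε hε A₀ (hA₀.trans hA) hfin hli

theorem finitelyRepresented_self (A : Set X) : FinitelyRepresented A A :=
  finitelyRepresented_of_exists_linearMap fun ε hε _ A₀ hA₀ _ _ =>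
    ⟨Submodule.subtype _, fun x hx => hA₀ hx, fun x => by
      have h1 : ‖Submodule.subtype _ x‖ = ‖x‖ := rfl
      rw [h1]
      constructor <;> nlinarith [norm_nonneg x]⟩

/-- A set finitely represented in a bounded set is bounded. -/
theorem FinitelyRepresented.isBounded {A : Set X} {B : Set Y} (h : FinitelyRepresented A B)
    (hB : Bornology.IsBounded B) : Bornology.IsBounded A := by
  obtain ⟨R, hR⟩ := hB.exists_norm_le
  rw [isBounded_iff_forall_norm_le]
  refine ⟨max 0 (2 * R), fun x hx => ?_⟩
  by_cases hx0 : x = 0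
  · simp [hx0]
  obtain ⟨S, hS, hn⟩ := h.exists_linearMap (ε := 1 / 2) (by norm_num) (A₀ := {x})
    (by simpa using hx) (Set.finite_singleton x) (LinearIndepOn.singleton hx0)
  let x' : Submodule.span ℝ {x} := ⟨x, Submodule.mem_span_singleton_self x⟩
  have h1 := hR _ (hS x' rfl)
  have h2 := (hn x').1
  have h3 : ‖x'‖ = ‖x‖ := rfl
  rw [h3] at h2
  exact le_max_of_le_right (by linarith)

/-- The convex hull of a linearly independent family in a set finitely represented in a convex
set is finitely represented there. -/
theorem FinitelyRepresented.convexHull_image {ι : Type*} {A : Set X} {B : Set Y}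
    (h : FinitelyRepresented A B) (hB : Convex ℝ B) {s : ι → X} {I : Set ι} (hI : I.Finite)
    (hs : ∀ i ∈ I, s i ∈ A) (hli : LinearIndepOn ℝ s I) :
    FinitelyRepresented (convexHull ℝ (s '' I)) B := by
  refine finitelyRepresented_of_exists_linearMap fun ε hε _ A₀ hA₀ _ _ => ?_
  -- One almost isometry on the span of the vertices serves every `A₀` in the hull, since linearity
  -- and convexity of `B` send the whole hull into `B`.
  obtain ⟨S, hS, hn⟩ := h.exists_linearMap hε (A₀ := s '' I)
    (by rintro _ ⟨i, hi, rfl⟩; exact hs i hi) (hI.image s) hli.id_image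
  have hsub : convexHull ℝ (s '' I) ⊆ Submodule.span ℝ (s '' I) :=
    convexHull_min Submodule.subset_span (Submodule.convex _)
  have hle : Submodule.span ℝ A₀ ≤ Submodule.span ℝ (s '' I) :=
    Submodule.span_le.2 (hA₀.trans hsub)
  have hconv : ∀ x : Submodule.span ℝ (s '' I), (x : X) ∈ convexHull ℝ (s '' I) → S x ∈ B := by
    have h1 : convexHull ℝ (s '' I) ⊆ (Submodule.subtype (Submodule.span ℝ (s '' I))) '' (S ⁻¹' B) := by
      refine convexHull_min ?_ ((hB.linear_preimage S).linear_image _)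
      intro x hx
      exact ⟨⟨x, Submodule.subset_span hx⟩, hS _ hx, rfl⟩
    intro x hx
    obtain ⟨y, hy, hyx⟩ := h1 hx
    rwa [Subtype.ext hyx] at hy
  exact ⟨S ∘ₗ Submodule.inclusion hle, fun x hx => hconv _ (hA₀ hx),
    fun x => hn (Submodule.inclusion hle x)⟩

/-- Linear maps on a finite-dimensional space that are asymptotically norm preserving at every
vector are eventually uniformly almost isometric. -/
theorem eventually_almost_isometric {V : Type*} [NormedAddCommGroup V] [NormedSpace ℝ V]
    [FiniteDimensional ℝ V] {Ω : Type*} {W : Filter Ω} {S : Ω → V →ₗ[ℝ] Y}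
    (h : ∀ v, Tendsto (fun w => ‖S w v‖) W (𝓝 ‖v‖)) {ε : ℝ} (hε : 0 < ε) :
    ∀ᶠ w in W, ∀ v, (1 - ε) * ‖v‖ ≤ ‖S w v‖ ∧ ‖S w v‖ ≤ (1 + ε) * ‖v‖ := by
  let b := Module.finBasis ℝ V
  obtain ⟨K, hK0, hK⟩ : ∃ K : ℝ, 0 < K ∧ ∀ᶠ w in W, ∀ v, ‖S w v‖ ≤ K * ‖v‖ := by
    let e := b.equivFunL
    let e' : V →L[ℝ] (Fin (Module.finrank ℝ V) → ℝ) := e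
    refine ⟨∑ i, (‖b i‖ + 1) * ‖e'‖ + 1, by positivity, ?_⟩
    have h1 : ∀ᶠ w in W, ∀ i, ‖S w (b i)‖ < ‖b i‖ + 1 :=
      eventually_all.2 fun i => (h (b i)).eventually_lt_const (by linarith)
    filter_upwards [h1] with w hw v
    calc ‖S w v‖ = ‖∑ i, e v i • S w (b i)‖ := by
          conv_lhs => rw [← b.sum_equivFun v, map_sum]
          simp only [map_smul]
          rfl
      _ ≤ ∑ i, ‖e v i • S w (b i)‖ := norm_sum_le _ _
      _ ≤ ∑ i, (‖b i‖ + 1) * ‖e'‖ * ‖v‖ := by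
          refine Finset.sum_le_sum fun i _ => ?_
          rw [norm_smul, mul_comm, mul_assoc]
          refine mul_le_mul (hw i).le ?_ (norm_nonneg _) (by positivity)
          exact (norm_le_pi_norm (e v) i).trans (e'.le_opNorm v)
      _ = (∑ i, (‖b i‖ + 1) * ‖e'‖) * ‖v‖ := by rw [Finset.sum_mul]
      _ ≤ _ := by nlinarith [norm_nonneg v]
  have : ProperSpace V := FiniteDimensional.proper ℝ V
  -- Passing to a net point costs `K * δ` in the image and `δ` in the source; the other `ε / 2` is
  -- the error on the net.
  obtain ⟨δ, hδ, hδε⟩ : ∃ δ : ℝ, 0 < δ ∧ K * δ + δ < ε / 2 :=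
    ⟨ε / 4 / (K + 1), by positivity, by field_simp; linarith⟩
  obtain ⟨t, -, htf, hts⟩ := (isCompact_sphere (0 : V) 1).finite_cover_balls hδ
  have h2 : ∀ᶠ w in W, ∀ x ∈ t, |‖S w x‖ - ‖x‖| < ε / 2 :=
    (eventually_all_finite htf).2 fun x _ => by
      have := (h x).eventually (Metric.ball_mem_nhds _ (half_pos hε))
      simpa [Real.dist_eq] using this
  filter_upwards [hK, h2] with w hw1 hw2 v
  have key : ∀ v : V, ‖v‖ = 1 → |‖S w v‖ - 1| ≤ ε := by
    intro v hv
    have hv' : v ∈ Metric.sphere (0 : V) 1 := by simpa using hv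
    obtain ⟨x, hx, hvx⟩ := Set.mem_iUnion₂.1 (hts hv')
    have h3 := hw2 x hx
    rw [Metric.mem_ball, dist_eq_norm] at hvx
    have h4 : |‖S w v‖ - ‖S w x‖| ≤ K * δ := by
      refine (abs_norm_sub_norm_le _ _).trans ?_
      rw [← map_sub]
      exact (hw1 _).trans (mul_le_mul_of_nonneg_left hvx.le hK0.le)
    have h5 : |‖v‖ - ‖x‖| ≤ δ := (abs_norm_sub_norm_le _ _).trans hvx.le
    rw [hv] at h5
    rw [abs_le] at *
    rw [abs_lt] at h3
    constructor <;> linarith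
  by_cases hv : v = 0
  · simp [hv]
  have hpos : 0 < ‖v‖ := norm_pos_iff.2 hv
  have h6 := key (‖v‖⁻¹ • v) (by rw [norm_smul, norm_inv, norm_norm]; field_simp)
  rw [map_smul, norm_smul, norm_inv, norm_norm, abs_le] at h6
  have h7 : ‖v‖ * (‖v‖⁻¹ * ‖S w v‖) = ‖S w v‖ := by field_simp
  constructor <;> nlinarith

/-- The closure of a finitely represented set is finitely represented. -/
theorem FinitelyRepresented.closure {A : Set X} {B : Set Y} (h : FinitelyRepresented A B) :
    FinitelyRepresented (closure A) B := by
  refine finitelyRepresented_of_exists_intermediate (Y := X) fun ε hε A₀ hA₀ hfin hli =>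
    ⟨A, h, ?_⟩
  have : FiniteDimensional ℝ (Submodule.span ℝ A₀) := FiniteDimensional.span_of_finite ℝ hfin
  have h1 : ∀ x : X, ∃ u : ℕ → X, x ∈ A₀ → (∀ n, u n ∈ A) ∧ Tendsto u atTop (𝓝 x) := by
    intro x
    by_cases hx : x ∈ A₀
    · obtain ⟨u, hu⟩ := mem_closure_iff_seq_limit.1 (hA₀ hx)
      exact ⟨u, fun _ => hu⟩
    · exact ⟨fun _ => 0, fun h => (hx h).elim⟩
  choose u hu using h1
  choose S hS using fun n => hli.exists_linearMap_span (fun x => u x n)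
  have h2 : ∀ v : Submodule.span ℝ A₀, Tendsto (fun n => S n v) atTop (𝓝 (v : X)) := by
    rintro ⟨v, hv⟩
    induction hv using Submodule.span_induction with
    | mem x hx =>
      have := (hu x hx).2
      refine this.congr fun n => ?_
      rw [hS n _ hx]
    | zero =>
      have : (⟨0, Submodule.zero_mem _⟩ : Submodule.span ℝ A₀) = 0 := rfl
      simp [this]
    | add x y hx hy h3 h4 => exact (h3.add h4).congr fun n => (map_add (S n) _ _).symm
    | smul a x hx h3 => exact (h3.const_smul a).congr fun n => (map_smul (S n) a _).symm
  obtain ⟨n, hn⟩ := (eventually_almost_isometric (fun v => (h2 v).norm) hε).exists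
  exact ⟨S n, fun x hx => by rw [hS n x hx]; exact (hu _ hx).1 n, hn⟩

end FiniteRepresentability

/-! ### The mean ergodic theorem for affine maps -/

section MeanErgodic

variable {Y : Type*} [NormedAddCommGroup Y] [NormedSpace ℝ Y] {D : Set Y} {T : Y → Y}

theorem IsAffineSelfMap.iterate (hT : IsAffineSelfMap D T) (n : ℕ) :
    IsAffineSelfMap D T^[n] := by
  induction n with
  | zero => exact ⟨Set.mapsTo_id D, fun _ _ _ _ _ _ _ _ _ => rfl⟩
  | succ n ih =>
    refine ⟨hT.1.iterate _, fun x hx y hy a b ha hb hab => ?_⟩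
    simp only [Function.iterate_succ_apply']
    rw [ih.2 x hx y hy a b ha hb hab, hT.2 _ (ih.1 hx) _ (ih.1 hy) a b ha hb hab]

theorem IsAffineSelfMap.cesaroMean_combo (hT : IsAffineSelfMap D T) (n : ℕ) {x y : Y}
    (hx : x ∈ D) (hy : y ∈ D) {a b : ℝ} (ha : 0 ≤ a) (hb : 0 ≤ b) (hab : a + b = 1) :
    cesaroMean T n (a • x + b • y) = a • cesaroMean T n x + b • cesaroMean T n y := by
  simp only [cesaroMean, Finset.smul_sum, ← Finset.sum_add_distrib]
  refine Finset.sum_congr rfl fun k _ => ?_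
  rw [(hT.iterate k).2 x hx y hy a b ha hb hab, smul_add, smul_comm _ a, smul_comm _ b]

theorem cesaroMean_mem (hD : Convex ℝ D) {n : ℕ} (hn : n ≠ 0) {x : Y}
    (hx : ∀ k, T^[k] x ∈ D) : cesaroMean T n x ∈ D := by
  rw [cesaroMean, Finset.smul_sum]
  refine hD.sum_mem (fun _ _ => by positivity) ?_ fun k _ => hx k
  rw [Finset.sum_const, Finset.card_range, nsmul_eq_mul]
  exact mul_inv_cancel₀ (Nat.cast_ne_zero.2 hn)

theorem cesaroMean_of_fixed {y : Y} (hy : T y = y) {n : ℕ} (hn : n ≠ 0) :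
    cesaroMean T n y = y := by
  have h1 : ∀ k, T^[k] y = y := fun k => Function.iterate_fixed hy k
  simp only [cesaroMean, h1, Finset.sum_const, Finset.card_range]
  rw [← Nat.cast_smul_eq_nsmul ℝ, smul_smul, inv_mul_cancel₀ (Nat.cast_ne_zero.2 hn), one_smul]

theorem cesaroMean_apply_sub (x : Y) (n : ℕ) :
    cesaroMean T n (T x) - cesaroMean T n x = (n : ℝ)⁻¹ • (T^[n] x - x) := by
  simp only [cesaroMean, ← smul_sub, ← Finset.sum_sub_distrib, ← Function.iterate_succ_apply]
  rw [Finset.sum_range_sub (fun k => T^[k] x)]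
  rfl

/-- Lets Hahn–Banach and finite convex combinations be applied to `T` without extending it to a
linear map. -/
theorem IsAffineSelfMap.convex_graph (hD : Convex ℝ D) (hT : IsAffineSelfMap D T) :
    Convex ℝ {p : Y × Y | p.1 ∈ D ∧ p.2 = T p.1} := by
  rintro ⟨x, x'⟩ ⟨hx, hx'⟩ ⟨y, y'⟩ ⟨hy, hy'⟩ a b ha hb hab
  simp only at hx hx' hy hy'
  subst hx' hy'
  exact ⟨hD hx hy ha hb hab, (hT.2 x hx y hy a b ha hb hab).symm⟩

theorem IsAffineSelfMap.map_sum (hD : Convex ℝ D) (hT : IsAffineSelfMap D T) {ι : Type*}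
    (s : Finset ι) (w : ι → ℝ) (z : ι → Y) (hw : ∀ i ∈ s, 0 ≤ w i) (hw1 : ∑ i ∈ s, w i = 1)
    (hz : ∀ i ∈ s, z i ∈ D) : T (∑ i ∈ s, w i • z i) = ∑ i ∈ s, w i • T (z i) := by
  classical
  have := ((hT.convex_graph hD).sum_mem (t := s) (w := w) (z := fun i => (z i, T (z i))) hw hw1
    fun i hi => ⟨hz i hi, rfl⟩).2
  simpa [Prod.fst_sum, Prod.snd_sum] using this.symm

theorem IsAffineSelfMap.apply_cesaroMean (hD : Convex ℝ D) (hT : IsAffineSelfMap D T) {n : ℕ}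
    (hn : n ≠ 0) {x : Y} (hx : x ∈ D) : T (cesaroMean T n x) = cesaroMean T n (T x) := by
  rw [cesaroMean, Finset.smul_sum, hT.map_sum hD _ _ _ (fun _ _ => by positivity) ?_
    (fun k _ => hT.1.iterate k hx), cesaroMean, Finset.smul_sum]
  · simp only [← Function.iterate_succ_apply, ← Function.iterate_succ_apply' T]
  · rw [Finset.sum_const, Finset.card_range, nsmul_eq_mul]
    exact mul_inv_cancel₀ (Nat.cast_ne_zero.2 hn)

theorem tendsto_inv_smul_sub_iterate (hb : Bornology.IsBounded D) (hT : Set.MapsTo T D D) {x : Y}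
    (hx : x ∈ D) : Tendsto (fun n : ℕ => (n : ℝ)⁻¹ • (T^[n] x - x)) atTop (𝓝 0) := by
  obtain ⟨R, hR⟩ := hb.exists_norm_le
  refine squeeze_zero_norm (a := fun n : ℕ => (n : ℝ)⁻¹ * (2 * R)) (fun n => ?_) ?_
  · rw [norm_smul, norm_inv, Real.norm_natCast]
    refine mul_le_mul_of_nonneg_left ((norm_sub_le _ _).trans ?_) (by positivity)
    linarith [hR _ (hT.iterate n hx), hR x hx]
  · simpa using (tendsto_inv_atTop_nhds_zero_nat (𝕜 := ℝ)).mul_const (2 * R)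

/-- Points of the convex hull of an orbit have asymptotically the same Cesàro means. -/
theorem tendsto_cesaroMean_sub_of_mem_convexHull (hD : Convex ℝ D) (hb : Bornology.IsBounded D)
    (hT : IsAffineSelfMap D T) {x z : Y} (hx : x ∈ D)
    (hz : z ∈ convexHull ℝ (Set.range fun k => T^[k] x)) :
    Tendsto (fun n : ℕ => cesaroMean T n z - cesaroMean T n x) atTop (𝓝 0) := by
  -- The good points form a convex set, so only orbit points matter; consecutive ones differ by a
  -- telescoping sum divided by `n`.
  let G : Set Y := {z | z ∈ D ∧
    Tendsto (fun n : ℕ => cesaroMean T n z - cesaroMean T n x) atTop (𝓝 0)}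
  have hG : Convex ℝ G := by
    rintro y ⟨hy, hy'⟩ z ⟨hz, hz'⟩ a b ha hb hab
    refine ⟨hD hy hz ha hb hab, ?_⟩
    have := (hy'.const_smul a).add (hz'.const_smul b)
    rw [smul_zero, smul_zero, add_zero] at this
    refine this.congr fun n => ?_
    rw [hT.cesaroMean_combo n hy hz ha hb hab]
    have h1 : cesaroMean T n x = a • cesaroMean T n x + b • cesaroMean T n x := by
      rw [← add_smul, hab, one_smul]
    conv_rhs => rw [h1]
    module
  suffices h : Set.range (fun k => T^[k] x) ⊆ G from (convexHull_min h hG hz).2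
  rintro _ ⟨k, rfl⟩
  induction k with
  | zero => exact ⟨hx, by simp⟩
  | succ k ih =>
    refine ⟨hT.1.iterate _ hx, ?_⟩
    have := (tendsto_inv_smul_sub_iterate hb hT.1 ih.1).add ih.2
    rw [add_zero] at this
    refine this.congr fun n => ?_
    simp only [Function.iterate_succ_apply']
    rw [← cesaroMean_apply_sub]
    abel

/-- The mean of order 2 alone suffices, as `T x = 2 S₂ x - x`; it has index 1 in the family. -/
theorem IsCesaroEquicontinuousOn.continuousOn (hT : IsCesaroEquicontinuousOn D T) :
    ContinuousOn T D := by
  have h1 : ContinuousOn (fun x => cesaroMean T 2 x) D := EquicontinuousOn.continuousOn hT 1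
  have h2 : Set.EqOn T (fun x => (2 : ℝ) • cesaroMean T 2 x - x) D := fun x _ => by
    simp [cesaroMean, Finset.sum_range_succ, smul_smul]
  exact ((h1.const_smul (2 : ℝ)).sub (continuousOn_id (s := D))).congr h2

/-- A continuous affine self-map of a relatively weakly compact set has a fixed point in the closed
convex hull of every orbit. -/
theorem exists_fixed_mem_closure_convexHull (hD : Convex ℝ D)
    (hcl : IsClosed D) (hb : Bornology.IsBounded D) (hc : IsRelativelyWeaklyCompact D)
    (hT : IsAffineSelfMap D T) (hcont : ContinuousOn T D) {x : Y} (hx : x ∈ D) :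
    ∃ y ∈ D, T y = y ∧ y ∈ closure (convexHull ℝ (Set.range fun k => T^[k] x)) := by
  let U : Filter ℕ := hyperfilter ℕ
  have hU : U ≤ atTop := Nat.hyperfilter_le_atTop
  let u : ℕ → WeakSpace ℝ Y := fun n => toWeakSpace ℝ Y (cesaroMean T n x)
  -- The mean of order 0 is the vector 0, which may lie outside `D`.
  have hn0 : ∀ᶠ n in U, n ≠ 0 := hU (eventually_ne_atTop 0)
  obtain ⟨y', -, hy'⟩ := hc.ultrafilter_le_nhds ((hyperfilter ℕ).map u) (by
    rw [le_principal_iff]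
    change ∀ᶠ n in U, u n ∈ _
    filter_upwards [hn0] with n hn
    exact subset_closure ⟨_, cesaroMean_mem hD hn fun k => hT.1.iterate k hx, rfl⟩)
  obtain ⟨y, rfl⟩ := (toWeakSpace ℝ Y).surjective y'
  have hlim : ∀ f : StrongDual ℝ Y, Tendsto (fun n => f (cesaroMean T n x)) U (𝓝 (f y)) := by
    intro f
    have h1 : Tendsto u U (𝓝 (toWeakSpace ℝ Y y)) := hy'
    exact ((WeakBilin.eval_continuous (topDualPairing ℝ Y).flip f).tendsto _).comp h1
  have hmem : ∀ K : Set Y, Convex ℝ K → (∀ᶠ n in U, cesaroMean T n x ∈ K) → y ∈ closure K := by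
    intro K hK hev
    by_contra hy
    obtain ⟨f, c, hf1, hf2⟩ := geometric_hahn_banach_closed_point hK.closure isClosed_closure hy
    refine absurd (le_of_tendsto (hlim f) ?_) (not_le.2 hf2)
    filter_upwards [hev] with n hn
    exact (hf1 _ (subset_closure hn)).le
  have hyD : y ∈ D := by
    rw [← hcl.closure_eq]
    exact hmem D hD (hn0.mono fun n hn => cesaroMean_mem hD hn fun k => hT.1.iterate k hx)
  refine ⟨y, hyD, ?_, hmem _ (convex_convexHull ℝ _) (hn0.mono fun n hn =>
    cesaroMean_mem (convex_convexHull ℝ _) hn fun k => subset_convexHull ℝ _ ⟨k, rfl⟩)⟩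
  have hG := hT.convex_graph hD
  -- Weak continuity of `T` is not available. Instead `T (Sₙ x) - Sₙ x = (Tⁿ x - x) / n` tends to 0,
  -- so `(y, y)` is a weak limit of graph points, hence a norm limit by convexity.
  have hyG : (y, y) ∈ closure {p : Y × Y | p.1 ∈ D ∧ p.2 = T p.1} := by
    by_contra hy
    obtain ⟨f, c, hf1, hf2⟩ := geometric_hahn_banach_closed_point hG.closure isClosed_closure hy
    have h1 := hlim (f.comp ((ContinuousLinearMap.id ℝ Y).prod (ContinuousLinearMap.id ℝ Y)))
    have h2 : Tendsto (fun n : ℕ => f (0, (n : ℝ)⁻¹ • (T^[n] x - x))) U (𝓝 (f (0, 0))) :=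
      (f.continuous.tendsto _).comp
        (tendsto_const_nhds.prodMk_nhds ((tendsto_inv_smul_sub_iterate hb hT.1 hx).mono_left hU))
    have h3 := h1.add h2
    rw [show ((0 : Y), (0 : Y)) = 0 from rfl, map_zero, add_zero] at h3
    refine absurd (le_of_tendsto h3 ?_) (not_le.2 hf2)
    filter_upwards [hn0] with n hn
    have h4 := hf1 (cesaroMean T n x, T (cesaroMean T n x))
      (subset_closure ⟨cesaroMean_mem hD hn fun k => hT.1.iterate k hx, rfl⟩)
    refine le_of_eq_of_le ?_ h4.le
    change f (cesaroMean T n x, cesaroMean T n x) + _ = _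
    rw [← map_add, ← cesaroMean_apply_sub, hT.apply_cesaroMean hD hn hx]
    simp
  obtain ⟨g, hg, hgt⟩ := mem_closure_iff_seq_limit.1 hyG
  have h5 : Tendsto (fun n => (g n).1) atTop (𝓝 y) := (continuous_fst.tendsto _).comp hgt
  have h6 : Tendsto (fun n => (g n).2) atTop (𝓝 y) := (continuous_snd.tendsto _).comp hgt
  have h7 : Tendsto (fun n => T (g n).1) atTop (𝓝 (T y)) :=
    (hcont y hyD).tendsto.comp
      (tendsto_nhdsWithin_iff.2 ⟨h5, Eventually.of_forall fun n => (hg n).1⟩)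
  exact tendsto_nhds_unique h7 (h6.congr fun n => (hg n).2)

/-- The mean ergodic theorem for Cesàro equicontinuous affine self-maps of relatively weakly
compact closed convex sets. -/
theorem IsRelativelyWeaklyCompact.isErgodicSet (hD : Convex ℝ D)
    (hcl : IsClosed D) (hb : Bornology.IsBounded D) (hc : IsRelativelyWeaklyCompact D) :
    IsErgodicSet D := by
  intro T hT hequi x hx
  obtain ⟨y, hyD, hfix, hy⟩ :=
    exists_fixed_mem_closure_convexHull hD hcl hb hc hT hequi.continuousOn hx
  refine ⟨y, Metric.tendsto_atTop'.2 fun ε hε => ?_⟩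
  -- A point `z` of the hull of the orbit close to `y` links the two: `Sₙ z` is near `Sₙ y = y`
  -- uniformly in `n`, and `Sₙ z - Sₙ x` tends to 0.
  obtain ⟨δ, hδ, h1⟩ := Metric.mem_nhdsWithin_iff.1
    (hequi y hyD _ (Metric.dist_mem_uniformity (half_pos hε)))
  obtain ⟨z, hz, hzy⟩ := Metric.mem_closure_iff.1 hy δ hδ
  have hzD : z ∈ D := convexHull_min (by rintro _ ⟨k, rfl⟩; exact hT.1.iterate k hx) hD hz
  have h2 := tendsto_cesaroMean_sub_of_mem_convexHull hD hb hT hx hz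
  obtain ⟨N, hN⟩ := Metric.tendsto_atTop'.1 h2 (ε / 2) (by positivity)
  refine ⟨N, fun n hn => ?_⟩
  have h3 := hN n hn
  rw [dist_zero_right] at h3
  have hn0 : n ≠ 0 := by omega
  have h4 := h1 ⟨by rwa [Metric.mem_ball, dist_comm], hzD⟩ (n - 1)
  simp only [Set.mem_ofPred_eq] at h4
  rw [Nat.sub_add_cancel (Nat.one_le_iff_ne_zero.2 hn0), cesaroMean_of_fixed hfix hn0] at h4
  calc dist (cesaroMean T n x) y
      ≤ dist (cesaroMean T n x) (cesaroMean T n z) + dist (cesaroMean T n z) y :=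
        dist_triangle _ _ _
    _ < ε / 2 + ε / 2 := by
        refine add_lt_add ?_ (by rwa [dist_comm])
        rwa [dist_comm, dist_eq_norm]
    _ = ε := add_halves ε

end MeanErgodic

/-! ### From super weak compactness to isometries -/

section Implications

variable {X : Type u} [NormedAddCommGroup X] [NormedSpace ℝ X] {C : Set X}

theorem IsSuperWeaklyCompact.isSuperErgodic (h : IsSuperWeaklyCompact.{u, v} C) :
    IsSuperErgodic.{u, v} C :=
  fun Y _ _ _ D hcl hD hfr =>
    IsRelativelyWeaklyCompact.isErgodicSet hD hcl (hfr.isBounded h.1) (h.2.2 Y D hfr)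

/-- An affine isometry of a convex set into itself extends to the closure. -/
theorem IsAffineSelfMap.exists_extension_closure {Y : Type*} [NormedAddCommGroup Y]
    [NormedSpace ℝ Y] [CompleteSpace Y] {D : Set Y} {T : Y → Y}
    (hT : IsAffineSelfMap D T) (hD : Convex ℝ D) (hiso : ∀ x ∈ D, ∀ y ∈ D, ‖T x - T y‖ = ‖x - y‖) :
    ∃ T' : Y → Y, Set.EqOn T' T D ∧ IsAffineSelfMap (closure D) T' ∧
      ∀ x ∈ closure D, ∀ y ∈ closure D, ‖T' x - T' y‖ = ‖x - y‖ := by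
  have hlip : LipschitzOnWith 1 T D := LipschitzOnWith.of_dist_le_mul fun x hx y hy => by
    rw [dist_eq_norm, dist_eq_norm, hiso x hx y hy, NNReal.coe_one, one_mul]
  have hlim : ∀ x ∈ closure D, ∃ y, Tendsto T (𝓝[D] x) (𝓝 y) := fun x hx => by
    have : NeBot (𝓝[D] x) := mem_closure_iff_nhdsWithin_neBot.1 hx
    refine CompleteSpace.complete (Metric.cauchy_iff.2 ⟨inferInstance, fun ε hε => ?_⟩)
    refine ⟨T '' (Metric.ball x (ε / 2) ∩ D),
      image_mem_map (inter_mem (mem_nhdsWithin_of_mem_nhds (Metric.ball_mem_nhds _ (half_pos hε)))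
        self_mem_nhdsWithin), ?_⟩
    rintro _ ⟨y, ⟨hy, hyD⟩, rfl⟩ _ ⟨z, ⟨hz, hzD⟩, rfl⟩
    rw [dist_eq_norm, hiso y hyD z hzD, ← dist_eq_norm]
    have := dist_triangle_right y z x
    rw [Metric.mem_ball] at hy hz
    linarith
  have heq : Set.EqOn (extendFrom D T) T D := extendFrom_extends hlip.continuousOn
  have hseq : ∀ x ∈ closure D, ∃ u : ℕ → Y, (∀ n, u n ∈ D) ∧ Tendsto u atTop (𝓝 x) ∧
      Tendsto (fun n => T (u n)) atTop (𝓝 (extendFrom D T x)) := fun x hx => by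
    obtain ⟨u, hu, hux⟩ := mem_closure_iff_seq_limit.1 hx
    exact ⟨u, hu, hux, (tendsto_extendFrom (hlim x hx)).comp
      (tendsto_nhdsWithin_iff.2 ⟨hux, Eventually.of_forall hu⟩)⟩
  refine ⟨extendFrom D T, heq, ⟨fun x hx => ?_, fun x hx y hy a b ha hb hab => ?_⟩,
    fun x hx y hy => ?_⟩
  · obtain ⟨u, hu, -, hut⟩ := hseq x hx
    exact mem_closure_of_tendsto hut (Eventually.of_forall fun n => hT.1 (hu n))
  · obtain ⟨p, hp, hpx, hpt⟩ := hseq x hx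
    obtain ⟨q, hq, hqy, hqt⟩ := hseq y hy
    have h1 : Tendsto (fun n => a • p n + b • q n) atTop (𝓝 (a • x + b • y)) :=
      (hpx.const_smul a).add (hqy.const_smul b)
    have h2 : ∀ n, a • p n + b • q n ∈ D := fun n => hD (hp n) (hq n) ha hb hab
    have h3 : a • x + b • y ∈ closure D := mem_closure_of_tendsto h1 (Eventually.of_forall h2)
    have h4 := (tendsto_extendFrom (hlim _ h3)).comp
      (tendsto_nhdsWithin_iff.2 ⟨h1, Eventually.of_forall h2⟩)
    refine tendsto_nhds_unique h4 (((hpt.const_smul a).add (hqt.const_smul b)).congr fun n => ?_)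
    exact (hT.2 _ (hp n) _ (hq n) a b ha hb hab).symm
  · obtain ⟨p, hp, hpx, hpt⟩ := hseq x hx
    obtain ⟨q, hq, hqy, hqt⟩ := hseq y hy
    exact tendsto_nhds_unique ((hpt.sub hqt).norm)
      (((hpx.sub hqy).norm).congr fun n => (hiso _ (hp n) _ (hq n)).symm)

/-- All iterates are isometric on `D`, so every mean is 1-Lipschitz there. -/
theorem isCesaroEquicontinuousOn_of_isometry {Y : Type*} [NormedAddCommGroup Y]
    [NormedSpace ℝ Y] {D : Set Y} {T : Y → Y} (hT : Set.MapsTo T D D)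
    (hiso : ∀ x ∈ D, ∀ y ∈ D, ‖T x - T y‖ = ‖x - y‖) : IsCesaroEquicontinuousOn D T := by
  have h1 : ∀ k, ∀ x ∈ D, ∀ y ∈ D, ‖T^[k] x - T^[k] y‖ = ‖x - y‖ := by
    intro k
    induction k with
    | zero => exact fun _ _ _ _ => rfl
    | succ k ih =>
      intro x hx y hy
      rw [Function.iterate_succ_apply, Function.iterate_succ_apply, ih _ (hT hx) _ (hT hy),
        hiso x hx y hy]
  intro x hx U hU
  obtain ⟨ε, hε, hεU⟩ := Metric.mem_uniformity_dist.1 hU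
  refine Metric.mem_nhdsWithin_iff.2 ⟨ε, hε, ?_⟩
  rintro y ⟨hyx, hy⟩ n
  refine hεU (lt_of_le_of_lt ?_ hyx)
  change dist (cesaroMean T (n + 1) x) (cesaroMean T (n + 1) y) ≤ dist y x
  rw [dist_eq_norm', dist_eq_norm, cesaroMean, cesaroMean, ← smul_sub, ← Finset.sum_sub_distrib,
    norm_smul, norm_inv, Real.norm_natCast]
  calc _ ≤ ((n + 1 : ℕ) : ℝ)⁻¹ * ∑ k ∈ Finset.range (n + 1), ‖y - x‖ := by
        refine mul_le_mul_of_nonneg_left ?_ (by positivity)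
        exact norm_sum_le_of_le _ fun k _ => (h1 k _ hy _ hx).le
    _ = ‖y - x‖ := by
        rw [Finset.sum_const, Finset.card_range, nsmul_eq_mul,
          inv_mul_cancel_left₀ (Nat.cast_ne_zero.2 n.succ_ne_zero)]

theorem IsSuperErgodic.affineIsometriesSuperErgodic (h : IsSuperErgodic.{u, v} C) :
    AffineIsometriesSuperErgodic.{u, v} C := by
  intro Y _ _ _ D hD hfr T hT hiso x hx
  obtain ⟨T', heq, hT', hiso'⟩ := hT.exists_extension_closure hD hiso
  obtain ⟨y, hy⟩ := h Y (closure D) isClosed_closure hD.closure hfr.closure T' hT'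
    (isCesaroEquicontinuousOn_of_isometry hT'.1 hiso') x (subset_closure hx)
  refine ⟨y, hy.congr fun n => ?_⟩
  have h1 : ∀ k, T'^[k] x = T^[k] x := by
    intro k
    induction k with
    | zero => rfl
    | succ k ih =>
      rw [Function.iterate_succ_apply', Function.iterate_succ_apply', ih, heq (hT.1.iterate k hx)]
  simp only [cesaroMean, h1]

end Implications

/-! ### The shift on a limit model of sequences -/

section ShiftModel

/-- Every seminorm is the pullback of the norm of a Banach space in any larger universe. -/
theorem Seminorm.exists_banach_model {E : Type u} [AddCommGroup E] [Module ℝ E]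
    (p : Seminorm ℝ E) :
    ∃ (Z : Type (max u v)) (_ : NormedAddCommGroup Z) (_ : NormedSpace ℝ Z) (_ : CompleteSpace Z)
      (J : E →ₗ[ℝ] Z), ∀ a, ‖J a‖ = p a := by
  let E' := ULift.{v} E
  let p' : Seminorm ℝ E' := p.comp (ULift.moduleEquiv (R := ℝ) (M := E)).toLinearMap
  let _ : SeminormedAddCommGroup E' := AddGroupSeminorm.toSeminormedAddCommGroup p'.toAddGroupSeminorm
  let _ : NormedSpace ℝ E' := { norm_smul_le := fun a x => (map_smul_eq_mul p' a x).le }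
  -- The completion is Hausdorff, so it also identifies vectors at seminorm distance zero.
  refine ⟨UniformSpace.Completion E', inferInstance, inferInstance, inferInstance,
    UniformSpace.Completion.toComplₗᵢ.toLinearMap ∘ₗ
      (ULift.moduleEquiv (R := ℝ) (M := E)).symm.toLinearMap, fun a => ?_⟩
  exact UniformSpace.Completion.norm_coe _

/-- The shift `(a₀, a₁, …) ↦ (0, a₀, a₁, …)` on finitely supported sequences. -/
noncomputable def finsuppShift : (ℕ →₀ ℝ) →ₗ[ℝ] (ℕ →₀ ℝ) :=
  Finsupp.lmapDomain ℝ ℝ Nat.succ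

/-- The convex hull of the unit vectors in the space of finitely supported sequences. -/
def finsuppSimplex : Set (ℕ →₀ ℝ) := convexHull ℝ (Set.range fun i => Finsupp.single i 1)

theorem finsuppShift_mem_simplex {a : ℕ →₀ ℝ} (ha : a ∈ finsuppSimplex) :
    finsuppShift a ∈ finsuppSimplex := by
  have h : finsuppShift '' finsuppSimplex ⊆ finsuppSimplex := by
    rw [finsuppSimplex, LinearMap.image_convexHull]
    refine convexHull_mono ?_
    rintro _ ⟨_, ⟨i, rfl⟩, rfl⟩
    exact ⟨i + 1, by simp [finsuppShift]⟩
  exact h ⟨a, ha, rfl⟩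

theorem sum_eq_one_of_mem_finsuppSimplex {a : ℕ →₀ ℝ} (ha : a ∈ finsuppSimplex) :
    Finsupp.linearCombination ℝ (fun _ => (1 : ℝ)) a = 1 := by
  have h : finsuppSimplex ⊆ Finsupp.linearCombination ℝ (fun _ => (1 : ℝ)) ⁻¹' {1} := by
    refine convexHull_min ?_ ((convex_singleton _).linear_preimage _)
    rintro _ ⟨i, rfl⟩
    simp
  exact h ha

variable {Y : Type*} [NormedAddCommGroup Y] [NormedSpace ℝ Y]

/-- The threshold depends on `a` only, so it can be fixed before `s` is chosen from the filter. -/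
theorem exists_linearCombination_mem_convexHull {a : ℕ →₀ ℝ} (ha : a ∈ finsuppSimplex) :
    ∃ m, ∀ n, m ≤ n → ∀ s : ℕ → Y,
      Finsupp.linearCombination ℝ s a ∈ convexHull ℝ (s '' Set.Iio n) := by
  let G : Set (ℕ →₀ ℝ) := {a | ∃ m, ∀ n, m ≤ n → ∀ s : ℕ → Y,
      Finsupp.linearCombination ℝ s a ∈ convexHull ℝ (s '' Set.Iio n)}
  have hG : Convex ℝ G := by
    rintro x ⟨m, hm⟩ y ⟨n, hn⟩ a b ha hb hab
    refine ⟨max m n, fun k hk s => ?_⟩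
    rw [map_add, map_smul, map_smul]
    exact convex_convexHull ℝ _ (hm k ((le_max_left _ _).trans hk) s)
      (hn k ((le_max_right _ _).trans hk) s) ha hb hab
  have h : finsuppSimplex ⊆ G := by
    refine convexHull_min ?_ hG
    rintro _ ⟨i, rfl⟩
    refine ⟨i + 1, fun n hn s => subset_convexHull ℝ _ ⟨i, hn, by simp⟩⟩
  exact h ha

/-- The seminorm obtained as the limit of the norms of linear combinations of random vectors. -/
theorem exists_limit_seminorm {W : Filter (ℕ → Y)} [NeBot W] {p : (ℕ →₀ ℝ) → ℝ}
    (hp : ∀ a, Tendsto (fun s => ‖Finsupp.linearCombination ℝ s a‖) W (𝓝 (p a))) :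
    ∃ q : Seminorm ℝ (ℕ →₀ ℝ), ∀ a, q a = p a := by
  refine ⟨Seminorm.of p (fun a b => ?_) fun c a => ?_, fun _ => rfl⟩
  · refine le_of_tendsto_of_tendsto' (hp (a + b)) ((hp a).add (hp b)) fun s => ?_
    rw [map_add]
    exact norm_add_le _ _
  · refine tendsto_nhds_unique (hp (c • a)) (((hp a).const_mul ‖c‖).congr fun s => ?_)
    rw [map_smul, norm_smul]

/-- A non-ergodic affine isometry exists on some convex set finitely represented in `C` as soon as
there is a limit model of sequences in `C` with a shift-invariant norm, in which blocks of unit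
vectors are separated in the mean. -/
theorem not_affineIsometriesSuperErgodic_of_model {X : Type u} [NormedAddCommGroup X]
    [NormedSpace ℝ X] {C : Set X} {W : Filter (ℕ → Y)} [NeBot W] {p : (ℕ →₀ ℝ) → ℝ}
    (hp : ∀ a, Tendsto (fun s => ‖Finsupp.linearCombination ℝ s a‖) W (𝓝 (p a)))
    (hfr : ∀ m, ∀ᶠ s in W, FinitelyRepresented (convexHull ℝ (s '' Set.Iio m)) C)
    (hshift : ∀ a, Finsupp.linearCombination ℝ (fun _ => (1 : ℝ)) a = 0 →
      p (finsuppShift a) = p a)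
    {θ : ℝ} (hθ : 0 < θ)
    (hsep : ∀ n : ℕ, n * θ ≤ p (∑ i ∈ Finset.range n,
      (Finsupp.single i 1 - Finsupp.single (n + i) 1))) :
    ¬ AffineIsometriesSuperErgodic.{u, v} C := by
  intro hC
  obtain ⟨q, hq⟩ := exists_limit_seminorm hp
  obtain ⟨Z, _, _, _, J, hJ⟩ := Seminorm.exists_banach_model.{0, v} q
  replace hJ : ∀ a, ‖J a‖ = p a := fun a => (hJ a).trans (hq a)
  let D : Set Z := J '' finsuppSimplex
  have hD : Convex ℝ D := (convex_convexHull ℝ _).linear_image J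
  -- Lift `A₀` to coefficient vectors through `R`. Along `W` the maps `v ↦ ∑ (R v)ᵢ sᵢ` become
  -- almost isometric and carry `A₀` into the hull of finitely many terms of `s`.
  have hDfr : FinitelyRepresented D C := by
    refine finitelyRepresented_of_exists_intermediate (Y := Y) fun ε hε A₀ hA₀ hfin hli => ?_
    have : FiniteDimensional ℝ (Submodule.span ℝ A₀) := FiniteDimensional.span_of_finite ℝ hfin
    have hA₀' : ∀ x, ∃ a, x ∈ A₀ → a ∈ finsuppSimplex ∧ J a = x := fun x => by
      by_cases hx : x ∈ A₀
      · obtain ⟨a, ha⟩ := hA₀ hx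
        exact ⟨a, fun _ => ha⟩
      · exact ⟨0, fun h => (hx h).elim⟩
    choose a ha using hA₀'
    obtain ⟨R, hR⟩ := hli.exists_linearMap_span a
    have hJR : J ∘ₗ R = Submodule.subtype _ := by
      refine LinearMap.ext fun ⟨x, hx⟩ => ?_
      induction hx using Submodule.span_induction with
      | mem x hx => exact (congrArg J (hR ⟨x, Submodule.subset_span hx⟩ hx)).trans (ha x hx).2
      | zero => exact map_zero (J ∘ₗ R)
      | add x y hx hy h1 h2 =>
        have := congrArg₂ (· + ·) h1 h2
        simp only [← map_add] at this
        exact this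
      | smul c x hx h1 =>
        have := congrArg (c • ·) h1
        simp only [← map_smul] at this
        exact this
    have hlim : ∀ v, Tendsto (fun s => ‖(Finsupp.linearCombination ℝ s ∘ₗ R) v‖) W (𝓝 ‖v‖) := by
      intro v
      have h1 : ‖v‖ = p (R v) := by
        rw [← hJ, ← LinearMap.comp_apply, hJR]
        rfl
      rw [h1]
      exact hp (R v)
    have hm : ∀ x, ∃ m, x ∈ A₀ → ∀ n, m ≤ n → ∀ s : ℕ → Y,
        Finsupp.linearCombination ℝ s (a x) ∈ convexHull ℝ (s '' Set.Iio n) := by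
      intro x
      by_cases hx : x ∈ A₀
      · obtain ⟨m, hm⟩ := exists_linearCombination_mem_convexHull (Y := Y) (ha x hx).1
        exact ⟨m, fun _ => hm⟩
      · exact ⟨0, fun h => (hx h).elim⟩
    choose m hm using hm
    obtain ⟨M, hM⟩ := (hfin.image m).bddAbove
    obtain ⟨s, hs1, hs2⟩ := ((eventually_almost_isometric hlim hε).and (hfr M)).exists
    refine ⟨_, hs2, Finsupp.linearCombination ℝ s ∘ₗ R, fun x hx => ?_, hs1⟩
    rw [LinearMap.comp_apply, hR x hx]
    exact hm _ hx _ (hM ⟨_, hx, rfl⟩) s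
  have hwd : ∀ a ∈ finsuppSimplex, ∀ b ∈ finsuppSimplex,
      ‖J (finsuppShift a) - J (finsuppShift b)‖ = ‖J a - J b‖ := by
    intro a ha b hb
    rw [← map_sub, ← map_sub, ← map_sub, hJ, hJ]
    refine hshift _ ?_
    rw [map_sub, sum_eq_one_of_mem_finsuppSimplex ha, sum_eq_one_of_mem_finsuppSimplex hb, sub_self]
  -- `J` need not be injective; `hwd` makes the value independent of the chosen preimage.
  obtain ⟨T, hT⟩ : ∃ T : Z → Z, ∀ a ∈ finsuppSimplex, T (J a) = J (finsuppShift a) := by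
    classical
    refine ⟨fun z => if h : z ∈ D then J (finsuppShift h.choose) else 0, fun a ha => ?_⟩
    have h : J a ∈ D := ⟨a, ha, rfl⟩
    simp only [dif_pos h]
    rw [← sub_eq_zero, ← norm_eq_zero, hwd _ h.choose_spec.1 _ ha, h.choose_spec.2, sub_self,
      norm_zero]
  have hTaff : IsAffineSelfMap D T := by
    constructor
    · rintro _ ⟨a, ha, rfl⟩
      exact ⟨_, finsuppShift_mem_simplex ha, (hT a ha).symm⟩
    · rintro _ ⟨x, hx, rfl⟩ _ ⟨y, hy, rfl⟩ a b ha hb hab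
      rw [← map_smul, ← map_smul, ← map_add, hT _ (convex_convexHull ℝ _ hx hy ha hb hab),
        hT x hx, hT y hy]
      simp only [map_add, map_smul]
  have hTiso : ∀ x ∈ D, ∀ y ∈ D, ‖T x - T y‖ = ‖x - y‖ := by
    rintro _ ⟨x, hx, rfl⟩ _ ⟨y, hy, rfl⟩
    rw [hT x hx, hT y hy, hwd x hx y hy]
  have hsimp : ∀ i, Finsupp.single i 1 ∈ finsuppSimplex := fun i => subset_convexHull ℝ _ ⟨i, rfl⟩
  obtain ⟨y, hy⟩ := hC Z D hD hDfr T hTaff hTiso (J (Finsupp.single 0 1)) ⟨_, hsimp 0, rfl⟩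
  have hiter : ∀ k, T^[k] (J (Finsupp.single 0 1)) = J (Finsupp.single k 1) := by
    intro k
    induction k with
    | zero => rfl
    | succ k ih =>
      rw [Function.iterate_succ_apply', ih, hT _ (hsimp k)]
      simp [finsuppShift]
  -- `Sₙ - S₂ₙ` at the first unit vector is the block difference divided by `2n`, so the means are
  -- not Cauchy.
  have hdiff : ∀ n : ℕ, n ≠ 0 → θ / 2 ≤ ‖cesaroMean T n (J (Finsupp.single 0 1)) -
      cesaroMean T (n + n) (J (Finsupp.single 0 1))‖ := by
    intro n hn
    have hn' : (0 : ℝ) < n := Nat.cast_pos.2 (Nat.pos_of_ne_zero hn)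
    have h1 : cesaroMean T n (J (Finsupp.single 0 1)) -
        cesaroMean T (n + n) (J (Finsupp.single 0 1)) = (2 * n : ℝ)⁻¹ • J (∑ i ∈ Finset.range n,
      (Finsupp.single i 1 - Finsupp.single (n + i) 1)) := by
      simp only [cesaroMean, hiter, Finset.sum_range_add, map_sum, map_sub, Finset.sum_sub_distrib]
      have h2 : (n : ℝ)⁻¹ = 2 * (2 * n : ℝ)⁻¹ := by field_simp
      have h3 : ((n + n : ℕ) : ℝ)⁻¹ = (2 * n : ℝ)⁻¹ := by push_cast; ring
      rw [h3, h2]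
      module
    rw [h1, norm_smul, hJ, norm_inv, Real.norm_of_nonneg (by positivity)]
    calc θ / 2 = (2 * n : ℝ)⁻¹ * (n * θ) := by field_simp
      _ ≤ _ := mul_le_mul_of_nonneg_left (hsep n) (by positivity)
  have hlim := (hy.sub (hy.comp (tendsto_atTop_mono (fun n => Nat.le_add_right n n) tendsto_id))).norm
  rw [sub_self, norm_zero] at hlim
  have hev := (hlim.eventually_lt_const (half_pos hθ)).and (eventually_ne_atTop 0)
  obtain ⟨n, hn1, hn2⟩ := hev.exists
  exact absurd (hdiff n hn2) (not_le.2 hn1)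

end ShiftModel

/-! ### Boundedness of the set -/

section Unbounded

theorem Ultrafilter.exists_tendsto_of_eventually_abs_le {α : Type*} (U : Ultrafilter α)
    {f : α → ℝ} {R : ℝ} (h : ∀ᶠ x in (U : Filter α), |f x| ≤ R) :
    ∃ c, Tendsto f U (𝓝 c) := by
  obtain ⟨c, -, hc⟩ := (isCompact_Icc (a := -R) (b := R)).ultrafilter_le_nhds (U.map f)
    (le_principal_iff.2 (h.mono fun x hx => abs_le.1 hx))
  exact ⟨c, hc⟩

theorem linearCombination_finsuppShift {Y : Type*} [AddCommGroup Y] [Module ℝ Y] (s : ℕ → Y)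
    (a : ℕ →₀ ℝ) : Finsupp.linearCombination ℝ s (finsuppShift a) =
      Finsupp.linearCombination ℝ (fun i => s (i + 1)) a :=
  Finsupp.linearCombination_mapDomain ℝ Nat.succ a

theorem linearCombination_block {Y : Type*} [AddCommGroup Y] [Module ℝ Y] (s : ℕ → Y) (n : ℕ) :
    Finsupp.linearCombination ℝ s (∑ i ∈ Finset.range n,
      (Finsupp.single i 1 - Finsupp.single (n + i) 1)) =
      ∑ i ∈ Finset.range n, (s i - s (n + i)) := by
  simp [map_sum]

theorem norm_linearCombination_le {Y : Type*} [NormedAddCommGroup Y] [NormedSpace ℝ Y]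
    {s : ℕ → Y} {a : ℕ →₀ ℝ} {R : ℝ} (h : ∀ i ∈ a.support, ‖s i‖ ≤ R) :
    ‖Finsupp.linearCombination ℝ s a‖ ≤ ∑ i ∈ a.support, |a i| * R := by
  rw [Finsupp.linearCombination_apply, Finsupp.sum]
  refine norm_sum_le_of_le _ fun i hi => ?_
  rw [norm_smul, Real.norm_eq_abs]
  exact mul_le_mul_of_nonneg_left (h i hi) (abs_nonneg _)

variable {X : Type u} [NormedAddCommGroup X] [NormedSpace ℝ X] {C : Set X}

/-- An unbounded convex set contains arbitrarily long segments from `x₀`. In the limit they become a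
ray, on which the shift acts as a translation by a unit vector. -/
theorem AffineIsometriesSuperErgodic.isBounded (hC : Convex ℝ C)
    (h : AffineIsometriesSuperErgodic.{u, v} C) : Bornology.IsBounded C := by
  by_contra hb
  obtain ⟨x₀, hx₀⟩ : C.Nonempty := by
    by_contra hne
    exact hb (by simp [Set.not_nonempty_iff_eq_empty.1 hne])
  have hfar : ∀ n : ℕ, ∃ u : X, ‖u‖ = 1 ∧ ∀ t : ℝ, 0 ≤ t → t ≤ n → x₀ + t • u ∈ C := by
    intro n
    obtain ⟨x, hx, hn⟩ : ∃ x ∈ C, (n : ℝ) + 1 < ‖x - x₀‖ := by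
      by_contra! hcon
      refine hb ((Metric.isBounded_closedBall (x := x₀) (r := (n : ℝ) + 1)).subset fun x hx => ?_)
      rw [Metric.mem_closedBall, dist_eq_norm]
      exact hcon x hx
    have hpos : 0 < ‖x - x₀‖ := lt_trans (by positivity) hn
    refine ⟨‖x - x₀‖⁻¹ • (x - x₀), ?_, fun t ht htn => ?_⟩
    · rw [norm_smul, norm_inv, norm_norm, inv_mul_cancel₀ hpos.ne']
    · rw [smul_smul]
      refine hC.add_smul_sub_mem hx₀ hx ⟨by positivity, ?_⟩
      rw [← div_eq_mul_inv, div_le_one hpos]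
      linarith
  choose u hu huC using hfar
  let s : ℕ → ℕ → X := fun n i => x₀ + (i : ℝ) • u n
  have hs : ∀ n i, ‖s n i‖ ≤ ‖x₀‖ + i := fun n i => by
    refine (norm_add_le _ _).trans_eq ?_
    rw [norm_smul, hu, mul_one, Real.norm_natCast]
  let W : Ultrafilter (ℕ → X) := (hyperfilter ℕ).map s
  have hW : ∀ a : ℕ →₀ ℝ, ∃ c,
      Tendsto (fun s : ℕ → X => ‖Finsupp.linearCombination ℝ s a‖) W (𝓝 c) := by
    intro a
    obtain ⟨M, hM⟩ := a.support.finite_toSet.bddAbove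
    refine W.exists_tendsto_of_eventually_abs_le
      (R := ∑ i ∈ a.support, |a i| * (‖x₀‖ + M)) (Eventually.of_forall (f := hyperfilter ℕ)
        (p := fun n => |‖Finsupp.linearCombination ℝ (s n) a‖| ≤ _) fun n => ?_)
    rw [abs_norm]
    refine norm_linearCombination_le fun i hi => (hs n i).trans ?_
    have : (i : ℝ) ≤ M := Nat.cast_le.2 (hM hi)
    linarith
  choose p hp using hW
  refine not_affineIsometriesSuperErgodic_of_model (p := p) (W := (W : Filter (ℕ → X))) hp
    (fun m => ?_) (fun a ha => ?_) one_pos (fun n => ?_) h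
  · have h1 : ∀ᶠ n in (hyperfilter ℕ : Filter ℕ), m ≤ n :=
      Nat.hyperfilter_le_atTop (eventually_ge_atTop m)
    have h2 : ∀ᶠ n in (hyperfilter ℕ : Filter ℕ),
        FinitelyRepresented (convexHull ℝ (s n '' Set.Iio m)) C := by
      filter_upwards [h1] with n hn
      refine (finitelyRepresented_self C).mono_left (convexHull_min ?_ hC)
      rintro _ ⟨i, hi, rfl⟩
      exact huC n i (Nat.cast_nonneg i) (Nat.cast_le.2 (le_trans (le_of_lt hi) hn))
    exact h2
  · have h1 : ∀ n, Finsupp.linearCombination ℝ (s n) (finsuppShift a) =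
        Finsupp.linearCombination ℝ (s n) a := fun n => by
      have h2 : (fun i => s n (i + 1)) = s n + fun i => (1 : ℝ) • u n := by
        funext i
        simp only [s, Pi.add_apply, Nat.cast_add, Nat.cast_one]
        module
      have h3 : Finsupp.linearCombination ℝ (fun _ : ℕ => (1 : ℝ) • u n) a = 0 := by
        have := congrArg (· • u n) ha
        simp only [Finsupp.linearCombination_apply, Finsupp.sum, Finset.sum_smul, smul_assoc,
          zero_smul] at this ⊢
        exact this
      rw [linearCombination_finsuppShift, h2]
      have h4 : ∀ f g : ℕ → X, Finsupp.linearCombination ℝ (f + g) a =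
          Finsupp.linearCombination ℝ f a + Finsupp.linearCombination ℝ g a := fun f g => by
        simp [Finsupp.linearCombination_apply, Finsupp.sum, smul_add, Finset.sum_add_distrib]
      rw [h4, h3, add_zero]
    have h5 := tendsto_map'_iff.1 (hp (finsuppShift a))
    exact tendsto_nhds_unique h5 ((tendsto_map'_iff.1 (hp a)).congr fun n =>
      congrArg norm (h1 n).symm)
  · refine ge_of_tendsto (tendsto_map'_iff.1 (hp _)) (Eventually.of_forall fun k => ?_)
    rw [Function.comp_apply, linearCombination_block]
    -- The `n` equal differences add up to norm `n²`, which is at least `n`.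
    have h1 : ∀ i, s k i - s k (n + i) = (-n : ℝ) • u k := fun i => by
      simp only [s, Nat.cast_add]
      module
    simp only [h1, Finset.sum_const, Finset.card_range]
    rw [← Nat.cast_smul_eq_nsmul ℝ, norm_smul, norm_smul, hu, norm_neg, Real.norm_natCast]
    rcases Nat.eq_zero_or_pos n with rfl | hn
    · simp
    · have : (1 : ℝ) ≤ n := Nat.one_le_cast.2 hn
      nlinarith

end Unbounded

/-! ### Iterated products of an ultrafilter -/

section IteratedUltrafilter

/-- Prepending a value to a sequence. -/
def seqCons {Y : Type*} (y : Y) (s : ℕ → Y) : ℕ → Y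
  | 0 => y
  | n + 1 => s n

/-- The `m`-fold product of an ultrafilter, viewed on sequences vanishing from the index `m` on. -/
noncomputable def iteratedUltrafilter {Y : Type*} [Zero Y] (V : Ultrafilter Y) :
    ℕ → Ultrafilter (ℕ → Y)
  | 0 => pure 0
  | m + 1 => V.bind fun y => (iteratedUltrafilter V m).map (seqCons y)

section Zero

variable {Y : Type*} [Zero Y] {V : Ultrafilter Y}

theorem eventually_iteratedUltrafilter_succ {m : ℕ} {P : (ℕ → Y) → Prop} :
    (∀ᶠ s in (iteratedUltrafilter V (m + 1) : Filter (ℕ → Y)), P s) ↔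
      ∀ᶠ y in (V : Filter Y), ∀ᶠ s in (iteratedUltrafilter V m : Filter (ℕ → Y)),
        P (seqCons y s) :=
  Iff.rfl

theorem eventually_iteratedUltrafilter_tail {m : ℕ} {P : (ℕ → Y) → Prop} :
    (∀ᶠ s in (iteratedUltrafilter V (m + 1) : Filter (ℕ → Y)), P fun i => s (i + 1)) ↔
      ∀ᶠ s in (iteratedUltrafilter V m : Filter (ℕ → Y)), P s := by
  rw [eventually_iteratedUltrafilter_succ]
  exact eventually_const (f := (V : Filter Y))
    (p := ∀ᶠ s in (iteratedUltrafilter V m : Filter (ℕ → Y)), P s)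

theorem eventually_iteratedUltrafilter_forall_lt {P : Y → Prop} (h : ∀ᶠ y in (V : Filter Y), P y)
    (m : ℕ) : ∀ᶠ s in (iteratedUltrafilter V m : Filter (ℕ → Y)), ∀ i < m, P (s i) := by
  induction m with
  | zero => exact Eventually.of_forall fun s i hi => absurd hi (Nat.not_lt_zero i)
  | succ m ih =>
    rw [eventually_iteratedUltrafilter_succ]
    filter_upwards [h] with y hy
    filter_upwards [ih] with s hs i hi
    cases i with
    | zero => exact hy
    | succ i => exact hs i (Nat.lt_of_succ_lt_succ hi)

/-- The products are coherent: the longer one has the shorter one as its marginal on the first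
coordinates. -/
theorem eventually_iteratedUltrafilter_iff_of_le {m n : ℕ} (hmn : m ≤ n) {P : (ℕ → Y) → Prop}
    (hP : ∀ s t, (∀ i < m, s i = t i) → (P s ↔ P t)) :
    (∀ᶠ s in (iteratedUltrafilter V n : Filter (ℕ → Y)), P s) ↔
      ∀ᶠ s in (iteratedUltrafilter V m : Filter (ℕ → Y)), P s := by
  induction m generalizing n P with
  | zero =>
    have h : ∀ s, P s ↔ P 0 := fun s => hP s 0 fun i hi => absurd hi (Nat.not_lt_zero i)
    simp only [h, eventually_const]
  | succ m ih =>
    obtain ⟨n, rfl⟩ : ∃ k, n = k + 1 := ⟨n - 1, by omega⟩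
    rw [eventually_iteratedUltrafilter_succ, eventually_iteratedUltrafilter_succ]
    refine eventually_congr (Eventually.of_forall fun y => ?_)
    refine ih (Nat.le_of_succ_le_succ hmn) fun s t hst => hP _ _ fun i hi => ?_
    cases i with
    | zero => rfl
    | succ i => exact hst i (Nat.lt_of_succ_lt_succ hi)

/-- The limit of the iterated products of an ultrafilter. -/
noncomputable def infiniteIterate (V : Ultrafilter Y) : Filter (ℕ → Y) :=
  Filter.bind atTop fun m => (iteratedUltrafilter V m : Filter (ℕ → Y))

theorem eventually_infiniteIterate {P : (ℕ → Y) → Prop} :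
    (∀ᶠ s in infiniteIterate V, P s) ↔
      ∀ᶠ m in atTop, ∀ᶠ s in (iteratedUltrafilter V m : Filter (ℕ → Y)), P s :=
  eventually_bind

instance infiniteIterate_neBot : NeBot (infiniteIterate V) := by
  rw [← frequently_true_iff_neBot, infiniteIterate, frequently_bind]
  exact Frequently.of_forall fun m => (frequently_true_iff_neBot _).2 inferInstance

theorem eventually_infiniteIterate_iff {m : ℕ} {P : (ℕ → Y) → Prop}
    (hP : ∀ s t, (∀ i < m, s i = t i) → (P s ↔ P t)) :
    (∀ᶠ s in infiniteIterate V, P s) ↔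
      ∀ᶠ s in (iteratedUltrafilter V m : Filter (ℕ → Y)), P s := by
  rw [eventually_infiniteIterate]
  constructor
  · intro h
    obtain ⟨n, hn, hmn⟩ := (h.and (eventually_ge_atTop m)).exists
    exact (eventually_iteratedUltrafilter_iff_of_le hmn hP).1 hn
  · intro h
    filter_upwards [eventually_ge_atTop m] with n hmn
    exact (eventually_iteratedUltrafilter_iff_of_le hmn hP).2 h

/-- Source of shift invariance: dropping the first coordinate of the product of order `m + 1` leaves
that of order `m`. -/
theorem tendsto_tail_infiniteIterate :
    Tendsto (fun (s : ℕ → Y) i => s (i + 1)) (infiniteIterate V) (infiniteIterate V) := by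
  intro P hP
  have h1 := eventually_infiniteIterate.1 (show ∀ᶠ s in infiniteIterate V, s ∈ P from hP)
  refine (eventually_infiniteIterate (P := fun s => (fun i => s (i + 1)) ∈ P)).2 ?_
  filter_upwards [(tendsto_sub_atTop_nat 1).eventually h1, eventually_ge_atTop 1] with n hn h1n
  obtain ⟨k, rfl⟩ : ∃ k, n = k + 1 := ⟨n - 1, by omega⟩
  exact eventually_iteratedUltrafilter_tail.2 hn

end Zero

variable {Y : Type*} [NormedAddCommGroup Y] [NormedSpace ℝ Y] {V : Ultrafilter Y}

theorem linearCombination_congr_of_lt {a : ℕ →₀ ℝ} {m : ℕ} (hm : ∀ i ∈ a.support, i < m)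
    {s t : ℕ → Y} (h : ∀ i < m, s i = t i) :
    Finsupp.linearCombination ℝ s a = Finsupp.linearCombination ℝ t a := by
  rw [Finsupp.linearCombination_apply, Finsupp.linearCombination_apply]
  exact Finset.sum_congr rfl fun i hi => congrArg (a i • ·) (h i (hm i hi))

theorem exists_tendsto_infiniteIterate {R : ℝ} (hR : ∀ᶠ y in (V : Filter Y), ‖y‖ ≤ R)
    (a : ℕ →₀ ℝ) : ∃ c, Tendsto (fun s : ℕ → Y => ‖Finsupp.linearCombination ℝ s a‖)
      (infiniteIterate V) (𝓝 c) := by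
  obtain ⟨M, hM⟩ := a.support.finite_toSet.bddAbove
  have hM' : ∀ i ∈ a.support, i < M + 1 := fun i hi => Nat.lt_succ_of_le (hM hi)
  obtain ⟨c, hc⟩ := (iteratedUltrafilter V (M + 1)).exists_tendsto_of_eventually_abs_le
    (f := fun s : ℕ → Y => ‖Finsupp.linearCombination ℝ s a‖)
    (R := ∑ i ∈ a.support, |a i| * R) (by
      filter_upwards [eventually_iteratedUltrafilter_forall_lt hR (M + 1)] with s hs
      rw [abs_norm]
      exact norm_linearCombination_le fun i hi => hs i (hM' i hi))
  refine ⟨c, fun U hU => (eventually_infiniteIterate_iff (m := M + 1)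
    (P := fun s => ‖Finsupp.linearCombination ℝ s a‖ ∈ U) fun s t hst => ?_).2 (hc hU)⟩
  rw [linearCombination_congr_of_lt hM' hst]

/-- If an ultrafilter contains no finite-dimensional subspace then the sequences it generates are
linearly independent. -/
theorem eventually_linearIndepOn_iteratedUltrafilter
    (hV : ∀ F : Submodule ℝ Y, FiniteDimensional ℝ F → ∀ᶠ y in (V : Filter Y), y ∉ F) (m : ℕ) :
    ∀ᶠ s in (iteratedUltrafilter V m : Filter (ℕ → Y)), LinearIndepOn ℝ s (Set.Iio m) := by
  -- Independence modulo an arbitrary `F` is what the induction carries: the first vector is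
  -- absorbed into `F` before the later ones are chosen.
  have key : ∀ F : Submodule ℝ Y, FiniteDimensional ℝ F →
      ∀ᶠ s in (iteratedUltrafilter V m : Filter (ℕ → Y)), ∀ a : ℕ → ℝ,
        ∑ i ∈ Finset.range m, a i • s i ∈ F → ∀ i < m, a i = 0 := by
    induction m with
    | zero => exact fun F _ => Eventually.of_forall fun s a _ i hi => absurd hi (Nat.not_lt_zero i)
    | succ m ih =>
      intro F hF
      rw [eventually_iteratedUltrafilter_succ]
      filter_upwards [hV F hF] with y hy
      have hF' : FiniteDimensional ℝ (F ⊔ Submodule.span ℝ {y} : Submodule ℝ Y) := inferInstance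
      filter_upwards [ih _ hF'] with s hs a ha
      rw [Finset.sum_range_succ'] at ha
      simp only [seqCons] at ha
      have h1 : ∀ i < m, a (i + 1) = 0 := by
        refine hs (fun i => a (i + 1)) ?_
        have h2 := Submodule.sub_mem _ (Submodule.mem_sup_left (T := Submodule.span ℝ {y}) ha)
          (Submodule.mem_sup_right (Submodule.smul_mem _ (a 0) (Submodule.mem_span_singleton_self y)))
        rwa [add_sub_cancel_right] at h2
      have h3 : a 0 = 0 := by
        rw [Finset.sum_eq_zero fun i hi => by rw [h1 i (Finset.mem_range.1 hi), zero_smul],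
          zero_add] at ha
        by_contra h0
        exact hy ((Submodule.smul_mem_iff _ h0).1 ha)
      intro i hi
      cases i with
      | zero => exact h3
      | succ i => exact h1 i (Nat.lt_of_succ_lt_succ hi)
  filter_upwards [key ⊥ inferInstance] with s hs
  rw [← Finset.coe_range, linearIndepOn_finset_iff]
  intro a ha i hi
  exact hs a (by rw [ha]; exact Submodule.zero_mem _) i (Finset.mem_range.1 hi)

variable {φ : StrongDual ℝ (StrongDual ℝ Y)}

/-- The functional is chosen from `z` before the `sᵢ`. Each `f (sᵢ)` tends to `φ f`, so `f` of the
vector tends to `f z - φ f`. -/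
theorem eventually_iteratedUltrafilter_lt_norm_add_sum
    (hφ : ∀ f : StrongDual ℝ Y, Tendsto f V (𝓝 (φ f))) {θ : ℝ}
    (hθ : ∀ z : Y, ∃ f : StrongDual ℝ Y, ‖f‖ ≤ 1 ∧ θ < f z - φ f) (m : ℕ) (c : ℕ → ℝ)
    (hc : ∑ i ∈ Finset.range m, c i = -1) (z : Y) :
    ∀ᶠ s in (iteratedUltrafilter V m : Filter (ℕ → Y)),
      θ < ‖z + ∑ i ∈ Finset.range m, c i • s i‖ := by
  obtain ⟨f, hf1, hf2⟩ := hθ z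
  have h1 : ∀ i ∈ Finset.range m,
      Tendsto (fun s : ℕ → Y => c i * f (s i)) (iteratedUltrafilter V m) (𝓝 (c i * φ f)) :=
    fun i hi => Tendsto.const_mul _ fun U hU =>
      (eventually_iteratedUltrafilter_forall_lt (hφ f hU) m).mono fun s hs =>
        hs i (Finset.mem_range.1 hi)
  have h2 := (tendsto_finsetSum _ h1).const_add (f z)
  rw [← Finset.sum_mul, hc, neg_one_mul, ← sub_eq_add_neg] at h2
  filter_upwards [h2.eventually_const_lt hf2] with s hs
  have h3 : f (z + ∑ i ∈ Finset.range m, c i • s i) =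
      f z + ∑ i ∈ Finset.range m, c i * f (s i) := by simp [map_sum]
  rw [← h3] at hs
  calc θ < _ := hs
    _ ≤ ‖f (z + ∑ i ∈ Finset.range m, c i • s i)‖ := Real.le_norm_self _
    _ ≤ ‖f‖ * _ := f.le_opNorm _
    _ ≤ _ := mul_le_of_le_one_left (norm_nonneg _) hf1

/-- The leading coordinates are absorbed into `z` one by one; this needs `θ` to be uniform in `z`.
-/
theorem eventually_iteratedUltrafilter_lt_norm_add_sum_add
    (hφ : ∀ f : StrongDual ℝ Y, Tendsto f V (𝓝 (φ f))) {θ : ℝ}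
    (hθ : ∀ z : Y, ∃ f : StrongDual ℝ Y, ‖f‖ ≤ 1 ∧ θ < f z - φ f) (m n : ℕ) (b c : ℕ → ℝ)
    (hc : ∑ i ∈ Finset.range m, c i = -1) (z : Y) :
    ∀ᶠ s in (iteratedUltrafilter V (m + n) : Filter (ℕ → Y)),
      θ < ‖z + ∑ i ∈ Finset.range n, b i • s i + ∑ i ∈ Finset.range m, c i • s (n + i)‖ := by
  induction n generalizing b z with
  | zero =>
    simpa using eventually_iteratedUltrafilter_lt_norm_add_sum hφ hθ m c hc z
  | succ n ih =>
    rw [← add_assoc, eventually_iteratedUltrafilter_succ]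
    refine Eventually.of_forall fun y => ?_
    filter_upwards [ih (fun i => b (i + 1)) (z + b 0 • y)] with s hs
    rw [Finset.sum_range_succ']
    have h1 : ∀ i, seqCons y s (n + 1 + i) = s (n + i) := fun i => by
      rw [add_right_comm]
      rfl
    simp only [h1]
    simp only [seqCons]
    convert hs using 2
    abel

end IteratedUltrafilter

/-! ### Failure of weak compactness seen in the bidual -/

section WeakCompactness

variable {Y : Type*} [NormedAddCommGroup Y] [NormedSpace ℝ Y]

/-- A bounded set that is not relatively weakly compact carries an ultrafilter converging to a
point of the bidual outside the space. -/
theorem exists_ultrafilter_of_not_isRelativelyWeaklyCompact {D : Set Y}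
    (hb : Bornology.IsBounded D) (h : ¬ IsRelativelyWeaklyCompact D) :
    ∃ (V : Ultrafilter Y) (φ : StrongDual ℝ (StrongDual ℝ Y)), D ∈ V ∧
      (∀ f : StrongDual ℝ Y, Tendsto f V (𝓝 (φ f))) ∧
      φ ∉ Set.range (NormedSpace.inclusionInDoubleDual ℝ Y) := by
  have h1 : ¬ closure (NormedSpace.inclusionInDoubleDualWeak ℝ Y '' (toWeakSpace ℝ Y '' D)) ⊆
      Set.range (NormedSpace.inclusionInDoubleDualWeak ℝ Y) := fun hsub =>
    h (NormedSpace.isCompact_closure_of_isBounded ℝ Y _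
      (by rwa [Set.preimage_image_eq _ (toWeakSpace ℝ Y).injective]) hsub)
  obtain ⟨φ, hφ, hφ'⟩ := Set.not_subset.1 h1
  obtain ⟨U, hU, hUφ⟩ := mem_closure_iff_ultrafilter.1 hφ
  rw [Set.image_image] at hU
  refine ⟨Ultrafilter.ofComapInfPrincipal hU, WeakDual.toStrongDual φ,
    Ultrafilter.ofComapInfPrincipal_mem hU, fun f => ?_, ?_⟩
  · have h2 : Tendsto (fun y => NormedSpace.inclusionInDoubleDualWeak ℝ Y (toWeakSpace ℝ Y y))
        (Ultrafilter.ofComapInfPrincipal hU) (𝓝 φ) := by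
      have := Ultrafilter.ofComapInfPrincipal_eq_of_map hU
      rw [Tendsto, ← Ultrafilter.coe_map, this]
      exact hUφ
    exact ((WeakDual.eval_continuous f).tendsto φ).comp h2
  · rintro ⟨y, hy⟩
    exact hφ' ⟨toWeakSpace ℝ Y y, congrArg StrongDual.toWeakDual hy⟩

/-- A complete space is closed in its bidual, so `φ` has positive distance from it. Replacing `f` by
`-f` removes the absolute value. -/
theorem exists_separation_of_notMem_range [CompleteSpace Y] {φ : StrongDual ℝ (StrongDual ℝ Y)}
    (hφ : φ ∉ Set.range (NormedSpace.inclusionInDoubleDual ℝ Y)) :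
    ∃ θ : ℝ, 0 < θ ∧ ∀ z : Y, ∃ f : StrongDual ℝ Y, ‖f‖ ≤ 1 ∧ θ < f z - φ f := by
  have hiso : Isometry (NormedSpace.inclusionInDoubleDual ℝ Y) :=
    (NormedSpace.inclusionInDoubleDualLi (E := Y) ℝ).isometry
  have hcl : IsClosed (Set.range (NormedSpace.inclusionInDoubleDual ℝ Y)) :=
    hiso.isClosedEmbedding.isClosed_range
  obtain ⟨θ, hθ, hball⟩ := Metric.isOpen_iff.1 hcl.isOpen_compl φ hφ
  refine ⟨θ / 2, half_pos hθ, fun z => ?_⟩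
  by_contra! hcon
  have h1 : ‖NormedSpace.inclusionInDoubleDual ℝ Y z - φ‖ ≤ θ / 2 := by
    refine ContinuousLinearMap.opNorm_le_of_unit_norm (by positivity) fun f hf => ?_
    rw [Real.norm_eq_abs, abs_le]
    have h2 := hcon f hf.le
    have h3 := hcon (-f) (by rw [norm_neg, hf])
    rw [map_neg, neg_apply] at h3
    rw [sub_apply, NormedSpace.dual_def]
    constructor <;> linarith
  refine hball (a := NormedSpace.inclusionInDoubleDual ℝ Y z) ?_ ⟨z, rfl⟩
  have h2 : dist (NormedSpace.inclusionInDoubleDual ℝ Y z) φ =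
      ‖NormedSpace.inclusionInDoubleDual ℝ Y z - φ‖ :=
    dist_eq_norm (E := StrongDual ℝ (StrongDual ℝ Y)) _ _
  exact h2.trans_lt (h1.trans_lt (half_lt_self hθ))

/-- Otherwise `V` would live on a compact ball of `F` and converge in norm to a point representing
`φ`. -/
theorem eventually_notMem_of_finiteDimensional {V : Ultrafilter Y}
    {φ : StrongDual ℝ (StrongDual ℝ Y)} (hV : ∀ f : StrongDual ℝ Y, Tendsto f V (𝓝 (φ f)))
    (hφ : φ ∉ Set.range (NormedSpace.inclusionInDoubleDual ℝ Y)) {R : ℝ}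
    (hR : ∀ᶠ y in (V : Filter Y), ‖y‖ ≤ R) (F : Submodule ℝ Y) [FiniteDimensional ℝ F] :
    ∀ᶠ y in (V : Filter Y), y ∉ F := by
  rw [Ultrafilter.eventually_not]
  intro hF
  have : ProperSpace F := FiniteDimensional.proper ℝ F
  have hK : IsCompact (Submodule.subtype F '' Metric.closedBall 0 R) :=
    (isCompact_closedBall (0 : F) R).image continuous_subtype_val
  obtain ⟨y, -, hy⟩ := hK.ultrafilter_le_nhds V (le_principal_iff.2 (by
    filter_upwards [hF, hR] with x hx hxR
    exact ⟨⟨x, hx⟩, by simpa using hxR, rfl⟩))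
  refine hφ ⟨y, ContinuousLinearMap.ext fun f => ?_⟩
  exact tendsto_nhds_unique ((f.continuous.tendsto y).mono_left hy) (hV f)

end WeakCompactness

/-! ### Isometries force super weak compactness -/

section Main

variable {X : Type u} [NormedAddCommGroup X] [NormedSpace ℝ X] {C : Set X}

theorem AffineIsometriesSuperErgodic.isRelativelyWeaklyCompact (hC : Convex ℝ C)
    (hb : Bornology.IsBounded C) (h : AffineIsometriesSuperErgodic.{u, v} C) {Y : Type*}
    [NormedAddCommGroup Y] [NormedSpace ℝ Y] [CompleteSpace Y] {D : Set Y}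
    (hD : FinitelyRepresented D C) : IsRelativelyWeaklyCompact D := by
  by_contra hDc
  have hDb := hD.isBounded hb
  obtain ⟨R, hR⟩ := hDb.exists_norm_le
  obtain ⟨V, φ, hDV, hVφ, hφ⟩ := exists_ultrafilter_of_not_isRelativelyWeaklyCompact hDb hDc
  obtain ⟨θ, hθ, hsep⟩ := exists_separation_of_notMem_range hφ
  have hVR : ∀ᶠ y in (V : Filter Y), ‖y‖ ≤ R := Filter.mem_of_superset hDV hR
  choose p hp using exists_tendsto_infiniteIterate hVR
  refine not_affineIsometriesSuperErgodic_of_model (p := p) hp (fun m => ?_) (fun a _ => ?_) hθ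
    (fun n => ?_) h
  · refine eventually_infiniteIterate.2 ?_
    filter_upwards [eventually_ge_atTop m] with k hk
    have hfd : ∀ F : Submodule ℝ Y, FiniteDimensional ℝ F → ∀ᶠ y in (V : Filter Y), y ∉ F :=
      fun F _ => eventually_notMem_of_finiteDimensional hVφ hφ hVR F
    filter_upwards [eventually_linearIndepOn_iteratedUltrafilter hfd k,
      eventually_iteratedUltrafilter_forall_lt (show ∀ᶠ y in (V : Filter Y), y ∈ D from hDV) k]
      with s hs hsD
    exact hD.convexHull_image hC (Set.finite_Iio m)
      (fun i hi => hsD i (lt_of_lt_of_le hi hk)) (hs.mono (Set.Iio_subset_Iio hk))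
  · have h1 := (hp a).comp tendsto_tail_infiniteIterate
    refine tendsto_nhds_unique (hp _) (h1.congr fun s => ?_)
    rw [linearCombination_finsuppShift]
    rfl
  · rcases Nat.eq_zero_or_pos n with rfl | hn
    · have h1 : p 0 = 0 := tendsto_nhds_unique (hp 0) (by simp)
      simp [h1]
    have hn' : (0 : ℝ) < n := Nat.cast_pos.2 hn
    refine ge_of_tendsto (hp _) ?_
    simp only [linearCombination_block]
    refine (eventually_infiniteIterate_iff (m := n + n) fun s t hst => ?_).2 ?_
    · rw [Finset.sum_congr rfl fun i hi => ?_]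
      have := Finset.mem_range.1 hi
      rw [hst i (by omega), hst (n + i) (by omega)]
    · have h1 := eventually_iteratedUltrafilter_lt_norm_add_sum_add hVφ hsep n n
        (fun _ => (n : ℝ)⁻¹) (fun _ => -(n : ℝ)⁻¹)
        (by simp [hn'.ne']) 0
      filter_upwards [h1] with s hs
      have h2 : (0 : Y) + ∑ i ∈ Finset.range n, (n : ℝ)⁻¹ • s i +
          ∑ i ∈ Finset.range n, -(n : ℝ)⁻¹ • s (n + i) =
          (n : ℝ)⁻¹ • ∑ i ∈ Finset.range n, (s i - s (n + i)) := by
        rw [Finset.sum_sub_distrib, smul_sub, Finset.smul_sum, Finset.smul_sum]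
        simp [sub_eq_add_neg]
      rw [h2, norm_smul, norm_inv, Real.norm_natCast] at hs
      calc n * θ ≤ n * ((n : ℝ)⁻¹ * ‖∑ i ∈ Finset.range n, (s i - s (n + i))‖) :=
            mul_le_mul_of_nonneg_left hs.le hn'.le
        _ = _ := by field_simp

end Main

theorem mainTheorem1 {X : Type u} [NormedAddCommGroup X] [NormedSpace ℝ X] [CompleteSpace X]
    (C : Set X) (hclosed : IsClosed C) (hconvex : Convex ℝ C) :
    List.TFAE [IsSuperWeaklyCompact.{u, v} C, IsSuperErgodic.{u, v} C,
      AffineIsometriesSuperErgodic.{u, v} C] := by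
  tfae_have 1 → 2 := IsSuperWeaklyCompact.isSuperErgodic
  tfae_have 2 → 3 := IsSuperErgodic.affineIsometriesSuperErgodic
  tfae_have 3 → 1 := fun h => by
    have hb := h.isBounded hconvex
    refine ⟨hb, ?_, fun Y _ _ _ D hD => h.isRelativelyWeaklyCompact hconvex hb hD⟩
    -- Mazur: a norm closed convex set is weakly closed.
    have h1 := hconvex.toWeakSpace_closure ℝ
    rw [hclosed.closure_eq] at h1
    rw [h1]
    exact isClosed_closure
  tfae_finish
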